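/- Let $\Gamma$ be a discrete group that is icc, i.e. the conjugacy class of every $g\neq e$ in $\Gamma$ is infinite, and let $\mu$ be a probability measure on $\Gamma$ whose support generates $\Gamma$ as a group. Let $(X,\nu)$ be an ergodic $(\Gamma,\mu)$-space: $(X,\nu)$ is a probability space with a measurable, nonsingular action of $\Gamma$ (that is, $g\nu$ and $\nu$ have the same null sets for every $g\in\Gamma$), $\nu$ is $\mu$-stationary, $\nu=\sum_{g\in\Gamma}\mu(g)\,g\nu$, and every measurable set $E\subseteq X$ with $\nu(gE\,\triangle\,E)=0$ for all $g\in\Gamma$ satisfies $\nu(E)\in\{0,1\}$. Let $\Gamma\ltimes L^\infty(X)$ be the von Neumann crossed product, i.e. the von Neumann algebra on $\ell^2(\Gamma,L^2(X,\nu))$ generated by the operators $(\pi(f)\xi)(h)=\sigma_{h^{-1}}(f)\,\xi(h)$ for $f\in L^\infty(X,\nu)$, where $(\sigma_g f)(x)=f(g^{-1}x)$, and the unitaries $(\lambda_g\xi)(h)=\xi(g^{-1}h)$ for $g\in\Gamma$. Then the conjugation action $g\cdot a=\lambda_g a\lambda_g^*$ of $\Gamma$ on $\Gamma\ltimes L^\infty(X)$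 is ergodic: $$\{a\in\Gamma\ltimes L^\infty(X) : \lambda_g a\lambda_g^*=a \text{ for all } g\in\Gamma\}=\mathbb{C}1.$$ -/

import Mathlib

open MeasureTheory
open scoped ENNReal

noncomputable section

namespace CrossedProductErgodicity

/-- A group is icc if the conjugacy class of every nontrivial element is infinite. -/
def IsICC (Γ : Type*) [Group Γ] : Prop :=
  ∀ g : Γ, g ≠ 1 → {k : Γ | IsConj g k}.Infinite

/-- The action of `Γ` on `(X, ν)` is measurable and nonsingular: every `x ↦ g • x` is measurable
and maps `ν` to a measure absolutely continuous with respect to `ν`. Since this is asked of `g`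
and of `g⁻¹`, the measures `ν` and `g ν` have the same null sets. -/
class NonsingularAction (Γ : Type*) {X : Type*} [Group Γ] [MulAction Γ X] [MeasurableSpace X]
    (ν : Measure X) : Prop where
  quasiMeasurePreserving : ∀ g : Γ, Measure.QuasiMeasurePreserving (fun x : X => g • x) ν ν

/-- `ν` is `μ`-stationary: `ν = ∑ g, μ(g) g_* ν`. -/
def IsStationary {Γ X : Type*} [Group Γ] [MulAction Γ X] [MeasurableSpace X]
    (μ : PMF Γ) (ν : Measure X) : Prop :=
  ν = Measure.sum fun g : Γ => μ g • ν.map (fun x : X => g • x)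

/-- Ergodicity of a nonsingular action: every measurable set that is invariant modulo null sets is
null or conull. -/
def IsErgodicAction (Γ : Type*) {X : Type*} [Group Γ] [MulAction Γ X] [MeasurableSpace X]
    (ν : Measure X) : Prop :=
  ∀ s : Set X, MeasurableSet s → (∀ g : Γ, (fun x : X => g • x) ⁻¹' s =ᵐ[ν] s) →
    ν s = 0 ∨ ν sᶜ = 0

section CrossedProduct

variable (Γ : Type*) {X : Type*} [Group Γ] [MulAction Γ X] [MeasurableSpace X] (ν : Measure X)

variable {Γ ν} in
theorem memLp_top_comp_smul [NonsingularAction Γ ν] (f : Lp ℂ ∞ ν) (g : Γ) :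
    MemLp (fun x : X => f (g • x)) ∞ ν := by
  have hq := NonsingularAction.quasiMeasurePreserving (ν := ν) g
  have hb : ∀ᵐ x ∂ν, ‖f x‖ ≤ ‖f‖ := by
    filter_upwards [ae_le_eLpNormEssSup (f := f) (μ := ν)] with x hx
    rw [Lp.norm_def, eLpNorm_exponent_top, ← toReal_enorm]
    have hfin := Lp.eLpNorm_ne_top f
    rw [eLpNorm_exponent_top] at hfin
    exact ENNReal.toReal_mono hfin hx
  exact memLp_top_of_bound ((Lp.aestronglyMeasurable f).comp_quasiMeasurePreserving hq) ‖f‖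
    (hq.ae hb)

variable {Γ ν} in
/-- The action of `Γ` on `L^∞(X, ν)`: `(σ_g f)(x) = f (g⁻¹ x)`. -/
def translateLinf [NonsingularAction Γ ν] (g : Γ) (f : Lp ℂ ∞ ν) : Lp ℂ ∞ ν :=
  (memLp_top_comp_smul f g⁻¹).toLp (fun x : X => f (g⁻¹ • x))

variable {Γ ν} in
theorem norm_translateLinf_le [NonsingularAction Γ ν] (g : Γ) (f : Lp ℂ ∞ ν) :
    ‖translateLinf g f‖ ≤ ‖f‖ := by
  have hq := NonsingularAction.quasiMeasurePreserving (ν := ν) g⁻¹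
  rw [translateLinf, Lp.norm_toLp, Lp.norm_def]
  refine ENNReal.toReal_mono (Lp.eLpNorm_ne_top f) ?_
  rw [eLpNorm_exponent_top, eLpNorm_exponent_top]
  exact essSup_le_of_ae_le _ (hq.ae (ae_le_eLpNormEssSup (f := f) (μ := ν)))

variable {ν} in
/-- Multiplication by `f ∈ L^∞(X, ν)` as a bounded operator on `L²(X, ν)`. -/
def mulOp (f : Lp ℂ ∞ ν) : Lp ℂ 2 ν →L[ℂ] Lp ℂ 2 ν :=
  (ContinuousLinearMap.mul ℂ ℂ).holderL ν ∞ 2 2 f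

variable {ν} in
theorem norm_mulOp_le (f : Lp ℂ ∞ ν) : ‖mulOp f‖ ≤ ‖f‖ := by
  refine ContinuousLinearMap.opNorm_le_bound _ (norm_nonneg f) fun ξ => ?_
  have h := (ContinuousLinearMap.mul ℂ ℂ).norm_holder_apply_apply_le (r := 2) f ξ
  simpa [mulOp] using h

/-- The Hilbert space `ℓ²(Γ, L²(X, ν))`. -/
abbrev HilbertSp : Type _ := lp (fun _ : Γ => Lp ℂ 2 ν) 2

variable {ν} in
/-- The representation of `L^∞(X, ν)` on `ℓ²(Γ, L²(X, ν))`: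
`(π(f) ξ)(h) = σ_{h⁻¹}(f) ξ(h)`. -/
def piRep [NonsingularAction Γ ν] (f : Lp ℂ ∞ ν) : HilbertSp Γ ν →L[ℂ] HilbertSp Γ ν :=
  lp.mapCLM 2 (fun h : Γ => mulOp (translateLinf h⁻¹ f)) (norm_nonneg f)
    (fun h => (norm_mulOp_le _).trans (norm_translateLinf_le h⁻¹ f))

variable {Γ} in
/-- `(λ_g ξ)(h) = ξ(g⁻¹ h)`, as a linear isometric automorphism of `ℓ²(Γ, L²(X, ν))`. -/
def leftTranslation (g : Γ) : HilbertSp Γ ν ≃ₗᵢ[ℂ] HilbertSp Γ ν :=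
  have key : ∀ (k : Γ) (ξ : HilbertSp Γ ν), Memℓp (fun h : Γ => ξ (k * h)) 2 := fun k ξ =>
    memℓp_gen ((Equiv.mulLeft k).summable_iff.2 ((lp.memℓp ξ).summable (by norm_num)))
  { toFun := fun ξ => ⟨fun h => ξ (g⁻¹ * h), key g⁻¹ ξ⟩
    invFun := fun ξ => ⟨fun h => ξ (g * h), key g ξ⟩
    map_add' := fun _ _ => rfl
    map_smul' := fun _ _ => rfl
    left_inv := fun ξ => by
      apply lp.ext
      funext h
      exact congrArg (fun k => ξ k) (inv_mul_cancel_left g h)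
    right_inv := fun ξ => by
      apply lp.ext
      funext h
      exact congrArg (fun k => ξ k) (mul_inv_cancel_left g h)
    norm_map' := fun ξ => by
      rw [lp.norm_eq_tsum_rpow (by norm_num), lp.norm_eq_tsum_rpow (by norm_num)]
      congr 1
      exact (Equiv.mulLeft g⁻¹).tsum_eq fun h => ‖ξ h‖ ^ (2 : ℝ≥0∞).toReal }

/-- The unitary representation `g ↦ λ_g` of `Γ` on `ℓ²(Γ, L²(X, ν))`. -/
def leftRegular : Γ →* unitary (HilbertSp Γ ν →L[ℂ] HilbertSp Γ ν) where
  toFun g := Unitary.linearIsometryEquiv.symm (leftTranslation ν g)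
  map_one' := by
    rw [← map_one Unitary.linearIsometryEquiv.symm]
    congr 1
    ext1 ξ
    apply lp.ext
    funext h
    exact congrArg (fun k => ξ k) (by simp)
  map_mul' g k := by
    rw [← map_mul Unitary.linearIsometryEquiv.symm]
    congr 1
    ext1 ξ
    apply lp.ext
    funext h
    exact congrArg (fun l => ξ l) (by simp [mul_assoc])

/-- The von Neumann algebra generated by a set `S` of bounded operators: the double commutant
of `S ∪ S*`. -/
def vonNeumannGenerated {H : Type*} [NormedAddCommGroup H] [InnerProductSpace ℂ H]
    [CompleteSpace H] (S : Set (H →L[ℂ] H)) : VonNeumannAlgebra H where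
  toStarSubalgebra := StarSubalgebra.centralizer ℂ (StarSubalgebra.centralizer ℂ S)
  centralizer_centralizer' := by
    have h := StarSubalgebra.coe_centralizer_centralizer (R := ℂ) S
    exact (congrArg (fun T => Set.centralizer (Set.centralizer T)) h).trans
      ((Set.centralizer_centralizer_centralizer _).trans h.symm)

theorem subset_vonNeumannGenerated {H : Type*} [NormedAddCommGroup H] [InnerProductSpace ℂ H]
    [CompleteSpace H] (S : Set (H →L[ℂ] H)) :
    S ⊆ (vonNeumannGenerated S).toStarSubalgebra := by
  intro a ha
  exact StarAlgebra.adjoin_le_centralizer_centralizer ℂ S (StarAlgebra.subset_adjoin ℂ S ha)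

/-- The von Neumann crossed product `Γ ⋉ L^∞(X, ν)`: the von Neumann algebra on
`ℓ²(Γ, L²(X, ν))` generated by all `π(f)`, `f ∈ L^∞(X, ν)`, and all `λ_g`, `g ∈ Γ`. -/
def crossedProduct [NonsingularAction Γ ν] : VonNeumannAlgebra (HilbertSp Γ ν) :=
  vonNeumannGenerated
    (Set.range (fun f : Lp ℂ ∞ ν => piRep Γ f) ∪
      Set.range (fun g : Γ => (leftRegular Γ ν g : HilbertSp Γ ν →L[ℂ] HilbertSp Γ ν)))

theorem leftRegular_mem_crossedProduct [NonsingularAction Γ ν] (g : Γ) :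
    (leftRegular Γ ν g : HilbertSp Γ ν →L[ℂ] HilbertSp Γ ν) ∈
      (crossedProduct Γ ν).toStarSubalgebra :=
  subset_vonNeumannGenerated _ (Or.inr ⟨g, rfl⟩)

/-- The unitaries `λ_g`, as unitary elements of the crossed product. -/
def canonicalUnitary [NonsingularAction Γ ν] :
    Γ →* unitary (crossedProduct Γ ν).toStarSubalgebra where
  toFun g := ⟨⟨leftRegular Γ ν g, leftRegular_mem_crossedProduct Γ ν g⟩, by
    rw [Unitary.mem_iff]
    exact ⟨Subtype.ext (Unitary.coe_star_mul_self (leftRegular Γ ν g)),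
      Subtype.ext (Unitary.coe_mul_star_self (leftRegular Γ ν g))⟩⟩
  map_one' := by
    apply Subtype.ext
    apply Subtype.ext
    simp
  map_mul' g k := by
    apply Subtype.ext
    apply Subtype.ext
    simp

/-- The conjugation action of `Γ` on the crossed product by *-automorphisms,
`g · a = λ_g a λ_g*`. -/
def conjugationAction [NonsingularAction Γ ν] :
    Γ →* ((crossedProduct Γ ν).toStarSubalgebra ≃⋆ₐ[ℂ] (crossedProduct Γ ν).toStarSubalgebra) :=
  (Unitary.conjStarAlgAut ℂ (crossedProduct Γ ν).toStarSubalgebra).comp (canonicalUnitary Γ ν)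

end CrossedProduct

/-- An action of a group on a *-algebra by *-automorphisms is ergodic if its fixed-point
subalgebra is `ℂ 1`. -/
def IsErgodicAutAction {Γ A : Type*} [Group Γ] [Ring A] [StarRing A] [Algebra ℂ A]
    (α : Γ →* (A ≃⋆ₐ[ℂ] A)) : Prop :=
  {a : A | ∀ g : Γ, α g a = a} = Set.range (algebraMap ℂ A)

end CrossedProductErgodicity

end

noncomputable section

set_option linter.unusedSectionVars false

namespace CrossedProductErgodicity

/-! A fixed point `a` commutes with every `λ_g`. Put `η = a (δ_e ⊗ 1)`; its coordinates `η_g` are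
the Fourier coefficients of `a`. For `h` in the support of `μ`, the operator `R_h` (right
translation combined with composition by `h`) lies in the commutant of the crossed product and
agrees with `λ_h` on `δ_e ⊗ 1`. Hence `R_h η = λ_h η`, that is, `η_g ∘ h = η_{h⁻¹gh}`.

Integrating `|η_g|²` against the stationary measure shows that `g ↦ ‖η_g‖²` is summable and
`μ`-harmonic for conjugation; by the maximum principle and icc it vanishes off `e`. Moreover `η_e`
is invariant, hence a constant `c` by ergodicity. Thus `a` and `c` agree on `δ_e ⊗ 1`, which forces
`a = c`. -/

/-- On an icc group, a summable function that is harmonic for the conjugation action vanishes away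
from the identity: the set where it attains its maximum is finite and conjugation invariant. -/
theorem IsICC.eq_zero_of_conj_harmonic {Γ : Type*} [Group Γ] (hΓ : IsICC Γ) (μ : PMF Γ)
    (hμ : Subgroup.closure μ.support = ⊤) (φ : Γ → ℝ≥0∞) (hφ : ∑' g, φ g ≠ ∞)
    (hharm : ∀ g, φ g = ∑' h, μ h * φ (h⁻¹ * g * h)) (g : Γ) (hg : g ≠ 1) : φ g = 0 := by
  by_contra h0
  have hfin : {k | φ g ≤ φ k}.Finite := ENNReal.finite_const_le_of_tsum_ne_top hφ h0
  have hfin' : {k | k ≠ 1 ∧ φ g ≤ φ k}.Finite := hfin.subset fun k hk => hk.2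
  obtain ⟨m, ⟨hm1, hgm⟩, hmax⟩ := hfin'.exists_maximalFor φ _ ⟨g, hg, le_rfl⟩
  have hle : ∀ k, k ≠ 1 → φ k ≤ φ m := by
    intro k hk
    by_cases h : φ g ≤ φ k
    · by_contra hlt
      exact hlt (hmax ⟨hk, h⟩ (le_of_not_ge hlt))
    · exact (le_of_not_ge h).trans hgm
  have hmtop : φ m ≠ ∞ := ENNReal.ne_top_of_tsum_ne_top hφ m
  let S : Set Γ := {k | k ≠ 1 ∧ φ k = φ m}
  have hSfin : S.Finite := hfin.subset fun k hk => hgm.trans hk.2.ge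
  have hne : ∀ h k : Γ, k ≠ 1 → h⁻¹ * k * h ≠ 1 := by
    intro h k hk e
    apply hk
    have : k = h * (h⁻¹ * k * h) * h⁻¹ := by group
    rw [this, e]; group
  have hsupp : ∀ h ∈ μ.support, ∀ k ∈ S, h⁻¹ * k * h ∈ S := by
    rintro h hh k ⟨hk, hkm⟩
    -- Maximum principle: a strict drop at one `h` of positive mass would push the average strictly
    -- below the finite maximum.
    refine ⟨hne h k hk, le_antisymm (hle _ (hne h k hk)) (le_of_not_gt fun hlt => ?_)⟩
    have hsum : ∑' l, μ l * φ m = φ m := by rw [ENNReal.tsum_mul_right, μ.tsum_coe, one_mul]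
    have : ∑' l, μ l * φ (l⁻¹ * k * l) < ∑' l, μ l * φ m := by
      refine ENNReal.tsum_lt_tsum (i := h) ?_ (fun l => by gcongr; exact hle _ (hne l k hk)) ?_
      · rw [← hharm, hkm]; exact hmtop
      · exact ENNReal.mul_lt_mul_right (by simpa using hh) (μ.apply_ne_top h) hlt
    rw [← hharm, hsum, hkm] at this
    exact lt_irrefl _ this
  -- Both directions are carried through the induction, so that the inverse case is a swap.
  have hconj : ∀ h : Γ, ∀ k ∈ S, h⁻¹ * k * h ∈ S ∧ h * k * h⁻¹ ∈ S := by
    intro h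
    have hh : h ∈ Subgroup.closure μ.support := hμ ▸ Subgroup.mem_top h
    induction hh using Subgroup.closure_induction with
    | mem h hh =>
      intro k hk
      refine ⟨hsupp h hh k hk, ?_⟩
      have hinj : Function.Injective (fun l => h⁻¹ * l * h) := fun a b hab => by simpa using hab
      -- An injection of a finite set into itself is onto, which gives stability under the inverse
      -- conjugation.
      have himg : (fun l => h⁻¹ * l * h) '' S = S :=
        Set.eq_of_subset_of_ncard_le (Set.image_subset_iff.2 (hsupp h hh))
          (Set.ncard_image_of_injective S hinj).ge hSfin
      obtain ⟨l, hl, rfl⟩ := himg.ge hk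
      simpa [mul_assoc] using hl
    | one => simp
    | mul x y _ _ hx hy =>
      intro k hk
      constructor
      · simpa [mul_assoc] using (hy _ (hx k hk).1).1
      · simpa [mul_assoc] using (hx _ (hy k hk).2).2
    | inv x _ hx =>
      intro k hk
      simpa using (hx k hk).symm
  refine hΓ m hm1 (hSfin.subset fun k hk => ?_)
  obtain ⟨c, rfl⟩ := isConj_iff.1 hk
  exact (hconj c m ⟨hm1, rfl⟩).2

/-! ### Invariant functions and stationary measures -/

section Action

variable {Γ X : Type*} [Group Γ] [MulAction Γ X] [MeasurableSpace X] {ν : Measure X}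

/-- Every preimage of a measurable set is null or conull, and countably many such sets separate the
points of `β`. -/
theorem IsErgodicAction.ae_eq_const {β : Type*} [MeasurableSpace β] [Nonempty β]
    [MeasurableSpace.CountablySeparated β] (herg : IsErgodicAction Γ ν) {f : X → β}
    (hf : Measurable f) (hinv : ∀ g : Γ, (fun x => f (g • x)) =ᵐ[ν] f) :
    ∃ c, f =ᵐ[ν] fun _ => c := by
  refine Filter.exists_eventuallyEq_const_of_forall_separating MeasurableSet fun U hU => ?_
  rcases herg (f ⁻¹' U) (hf hU) fun g => by
    filter_upwards [hinv g] with x hx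
    exact congrArg (· ∈ U) hx with h | h
  · exact Or.inr (measure_eq_zero_iff_ae_notMem.1 h)
  · exact Or.inl h

/-- Invariance of a function modulo null sets needs only be checked on generators. -/
theorem ae_invariant_of_closure_eq_top [NonsingularAction Γ ν] {β : Type*} {f : X → β} {s : Set Γ}
    (hs : Subgroup.closure s = ⊤) (hinv : ∀ g ∈ s, (fun x => f (g • x)) =ᵐ[ν] f) (g : Γ) :
    (fun x => f (g • x)) =ᵐ[ν] f := by
  have hg : g ∈ Subgroup.closure s := hs ▸ Subgroup.mem_top g
  induction hg using Subgroup.closure_induction with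
  | mem g hg => exact hinv g hg
  | one => simp
  | mul x y _ _ hx hy =>
    filter_upwards [hy, (NonsingularAction.quasiMeasurePreserving (ν := ν) y).ae hx] with z h1 h2
    rw [mul_smul, h2, h1]
  | inv x _ hx =>
    filter_upwards [(NonsingularAction.quasiMeasurePreserving (ν := ν) x⁻¹).ae hx] with z h
    simpa using h.symm

theorem IsStationary.lintegral_eq [NonsingularAction Γ ν] {μ : PMF Γ} (hstat : IsStationary μ ν)
    {F : X → ℝ≥0∞} (hF : Measurable F) :
    ∫⁻ x, F x ∂ν = ∑' g : Γ, μ g * ∫⁻ x, F (g • x) ∂ν := by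
  conv_lhs => rw [hstat]
  rw [lintegral_sum_measure]
  congr 1 with g
  rw [lintegral_smul_measure, smul_eq_mul,
    lintegral_map hF (NonsingularAction.quasiMeasurePreserving (ν := ν) g).measurable]

/-- `μ h • h_* ν` is one summand of the stationarity formula. -/
theorem IsStationary.map_le_smul {μ : PMF Γ} (hstat : IsStationary μ ν)
    {h : Γ} (hh : h ∈ μ.support) : ν.map (fun x => h • x) ≤ (μ h)⁻¹ • ν := by
  have h0 : μ h ≠ 0 := by simpa using hh
  have hle : μ h • ν.map (fun x => h • x) ≤ ν := by
    conv_rhs => rw [hstat]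
    exact Measure.le_sum (fun g : Γ => μ g • ν.map (fun x : X => g • x)) h
  calc ν.map (fun x => h • x) = (μ h)⁻¹ • μ h • ν.map (fun x => h • x) := by
        rw [smul_smul, ENNReal.inv_mul_cancel h0 (μ.apply_ne_top h), one_smul]
    _ ≤ (μ h)⁻¹ • ν := by gcongr

theorem IsStationary.memLp_comp_smul [NonsingularAction Γ ν] {μ : PMF Γ}
    (hstat : IsStationary μ ν) {h : Γ} (hh : h ∈ μ.support) (f : Lp ℂ 2 ν) :
    MemLp (fun x => f (h • x)) 2 ν := by
  have h0 : μ h ≠ 0 := by simpa using hh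
  exact ((Lp.memLp f).of_measure_le_smul (ENNReal.inv_ne_top.2 h0)
    (hstat.map_le_smul hh)).comp_of_map
    (NonsingularAction.quasiMeasurePreserving (ν := ν) h).measurable.aemeasurable

theorem IsStationary.eLpNorm_comp_smul_le [NonsingularAction Γ ν] {μ : PMF Γ}
    (hstat : IsStationary μ ν) {h : Γ} (hh : h ∈ μ.support) (f : Lp ℂ 2 ν) :
    eLpNorm (fun x => f (h • x)) 2 ν ≤ (μ h)⁻¹ ^ (1 / (2 : ℝ≥0∞).toReal) * eLpNorm f 2 ν := by
  have h0 : μ h ≠ 0 := by simpa using hh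
  have hm := NonsingularAction.quasiMeasurePreserving (ν := ν) h
  have hf := (Lp.memLp f).of_measure_le_smul (ENNReal.inv_ne_top.2 h0) (hstat.map_le_smul hh)
  calc eLpNorm (fun x => f (h • x)) 2 ν = eLpNorm f 2 (ν.map (fun x => h • x)) :=
        (eLpNorm_map_measure hf.1 hm.measurable.aemeasurable).symm
    _ ≤ eLpNorm f 2 ((μ h)⁻¹ • ν) := eLpNorm_mono_measure _ (hstat.map_le_smul hh)
    _ = _ := by
      rw [eLpNorm_smul_measure_of_ne_top (by norm_num)]; simp

/-- For `h` in the support of `μ`, composition with `x ↦ h • x` is bounded on `L²(X, ν)` since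
`μ(h) h_* ν ≤ ν`. -/
def IsStationary.compOp [NonsingularAction Γ ν] {μ : PMF Γ}
    (hstat : IsStationary μ ν) {h : Γ} (hh : h ∈ μ.support) : Lp ℂ 2 ν →L[ℂ] Lp ℂ 2 ν :=
  LinearMap.mkContinuous
    { toFun := fun f => (hstat.memLp_comp_smul hh f).toLp (fun x => f (h • x))
      map_add' := fun f g => by
        rw [← MemLp.toLp_add, MemLp.toLp_eq_toLp_iff]
        exact (NonsingularAction.quasiMeasurePreserving (ν := ν) h).ae (Lp.coeFn_add f g)
      map_smul' := fun c f => by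
        rw [RingHom.id_apply, ← MemLp.toLp_const_smul, MemLp.toLp_eq_toLp_iff]
        exact (NonsingularAction.quasiMeasurePreserving (ν := ν) h).ae (Lp.coeFn_smul c f) }
    ((μ h)⁻¹ ^ (1 / (2 : ℝ≥0∞).toReal)).toReal
    (fun f => by
      have h0 : μ h ≠ 0 := by simpa using hh
      rw [LinearMap.coe_mk, AddHom.coe_mk, Lp.norm_toLp, Lp.norm_def, ← ENNReal.toReal_mul]
      refine ENNReal.toReal_mono (ENNReal.mul_ne_top ?_ (Lp.eLpNorm_ne_top f))
        (hstat.eLpNorm_comp_smul_le hh f)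
      exact ENNReal.rpow_ne_top_of_nonneg (by positivity) (ENNReal.inv_ne_top.2 h0))

theorem IsStationary.coeFn_compOp [NonsingularAction Γ ν] {μ : PMF Γ}
    (hstat : IsStationary μ ν) {h : Γ} (hh : h ∈ μ.support) (f : Lp ℂ 2 ν) :
    hstat.compOp hh f =ᵐ[ν] fun x => f (h • x) :=
  MemLp.coeFn_toLp (hstat.memLp_comp_smul hh f)

/-! ### Multiplication operators and the commutant of the crossed product -/

theorem coeFn_mulOp (f : Lp ℂ ∞ ν) (ξ : Lp ℂ 2 ν) : mulOp f ξ =ᵐ[ν] fun x => f x * ξ x :=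
  (ContinuousLinearMap.mul ℂ ℂ).coeFn_holder (r := 2) f ξ

theorem coeFn_translateLinf [NonsingularAction Γ ν] (g : Γ) (f : Lp ℂ ∞ ν) :
    translateLinf g f =ᵐ[ν] fun x => f (g⁻¹ • x) :=
  MemLp.coeFn_toLp _

theorem mulOp_comm (f g : Lp ℂ ∞ ν) (ξ : Lp ℂ 2 ν) :
    mulOp f (mulOp g ξ) = mulOp g (mulOp f ξ) := by
  apply Lp.ext
  filter_upwards [coeFn_mulOp f (mulOp g ξ), coeFn_mulOp g (mulOp f ξ), coeFn_mulOp f ξ,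
    coeFn_mulOp g ξ] with x h1 h2 h3 h4
  rw [h1, h2, h3, h4]; ring

theorem IsStationary.compOp_mulOp [NonsingularAction Γ ν] {μ : PMF Γ}
    (hstat : IsStationary μ ν) {h : Γ} (hh : h ∈ μ.support) (k : Γ) (f : Lp ℂ ∞ ν)
    (ξ : Lp ℂ 2 ν) :
    hstat.compOp hh (mulOp (translateLinf k f) ξ) =
      mulOp (translateLinf (h⁻¹ * k) f) (hstat.compOp hh ξ) := by
  have hq := NonsingularAction.quasiMeasurePreserving (ν := ν) h
  apply Lp.ext
  filter_upwards [hstat.coeFn_compOp hh (mulOp (translateLinf k f) ξ), hstat.coeFn_compOp hh ξ,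
    coeFn_mulOp (translateLinf (h⁻¹ * k) f) (hstat.compOp hh ξ),
    coeFn_translateLinf (h⁻¹ * k) f, hq.ae (coeFn_mulOp (translateLinf k f) ξ),
    hq.ae (coeFn_translateLinf k f)] with x h1 h2 h3 h4 h5 h6
  rw [h1, h3, h5, h6, h4, h2, mul_inv_rev, inv_inv, mul_smul]

theorem star_translateLinf [NonsingularAction Γ ν] (g : Γ) (f : Lp ℂ ∞ ν) :
    translateLinf g (star f) = star (translateLinf g f) := by
  have hq := NonsingularAction.quasiMeasurePreserving (ν := ν) g⁻¹
  apply Lp.ext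
  filter_upwards [coeFn_translateLinf g (star f), coeFn_translateLinf g f,
    Lp.coeFn_star (translateLinf g f), hq.ae (Lp.coeFn_star f)] with x h1 h2 h3 h4
  rw [h1, h3, h4, Pi.star_apply, Pi.star_apply, h2]

theorem inner_mulOp_left (f : Lp ℂ ∞ ν) (ξ ζ : Lp ℂ 2 ν) :
    inner ℂ (mulOp f ξ) ζ = inner ℂ ξ (mulOp (star f) ζ) := by
  rw [L2.inner_def, L2.inner_def]
  apply integral_congr_ae
  filter_upwards [coeFn_mulOp f ξ, coeFn_mulOp (star f) ζ, Lp.coeFn_star f] with x h1 h2 h3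
  rw [h1, h2, h3]
  simp only [RCLike.inner_apply, map_mul, Pi.star_apply, RCLike.star_def]
  ring

theorem piRep_apply [NonsingularAction Γ ν] (f : Lp ℂ ∞ ν) (ξ : HilbertSp Γ ν) (h : Γ) :
    piRep Γ f ξ h = mulOp (translateLinf h⁻¹ f) (ξ h) := rfl

theorem leftRegular_apply (g : Γ) (ξ : HilbertSp Γ ν) (h : Γ) :
    (leftRegular Γ ν g : HilbertSp Γ ν →L[ℂ] HilbertSp Γ ν) ξ h = ξ (g⁻¹ * h) := rfl

theorem star_piRep [NonsingularAction Γ ν] (f : Lp ℂ ∞ ν) :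
    star (piRep Γ f) = piRep Γ (star f) := by
  rw [ContinuousLinearMap.star_eq_adjoint]
  symm
  rw [ContinuousLinearMap.eq_adjoint_iff]
  intro ξ ζ
  rw [lp.inner_eq_tsum, lp.inner_eq_tsum]
  congr 1 with h
  rw [piRep_apply, piRep_apply, inner_mulOp_left, star_translateLinf, star_star]

theorem star_leftRegular (g : Γ) :
    star (leftRegular Γ ν g : HilbertSp Γ ν →L[ℂ] HilbertSp Γ ν) = leftRegular Γ ν g⁻¹ := by
  rw [map_inv, ← Unitary.coe_star, Unitary.star_eq_inv]

/-- An operator commuting with all `π(f)` and all `λ_g` commutes with the crossed product. -/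
theorem commute_of_mem_crossedProduct [NonsingularAction Γ ν]
    {a T : HilbertSp Γ ν →L[ℂ] HilbertSp Γ ν} (ha : a ∈ (crossedProduct Γ ν).toStarSubalgebra)
    (hπ : ∀ f : Lp ℂ ∞ ν, piRep Γ f * T = T * piRep Γ f)
    (hL : ∀ g : Γ, (leftRegular Γ ν g : HilbertSp Γ ν →L[ℂ] HilbertSp Γ ν) * T =
      T * leftRegular Γ ν g) : T * a = a * T := by
  -- The crossed product is a double commutant, so `T` need only commute with the generators and
  -- their adjoints, which are again generators.
  refine ((StarSubalgebra.mem_centralizer_iff ℂ).1 ha T ?_).1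
  refine (StarSubalgebra.mem_centralizer_iff ℂ).2 ?_
  rintro _ (⟨f, rfl⟩ | ⟨g, rfl⟩)
  · exact ⟨hπ f, by simpa only [star_piRep] using hπ (star f)⟩
  · exact ⟨hL g, by simpa only [star_leftRegular] using hL g⁻¹⟩

variable (Γ) in
/-- The diagonal operator `(ξ_h)_h ↦ (f ξ_h)_h` on `ℓ²(Γ, L²(X, ν))`. -/
def diagMulOp (f : Lp ℂ ∞ ν) : HilbertSp Γ ν →L[ℂ] HilbertSp Γ ν :=
  lp.mapCLM 2 (fun _ : Γ => mulOp f) (norm_nonneg f) (fun _ => norm_mulOp_le f)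

theorem diagMulOp_apply (f : Lp ℂ ∞ ν) (ξ : HilbertSp Γ ν) (h : Γ) :
    diagMulOp Γ f ξ h = mulOp f (ξ h) := rfl

theorem diagMulOp_commute [NonsingularAction Γ ν] (f : Lp ℂ ∞ ν)
    {a : HilbertSp Γ ν →L[ℂ] HilbertSp Γ ν} (ha : a ∈ (crossedProduct Γ ν).toStarSubalgebra) :
    diagMulOp Γ f * a = a * diagMulOp Γ f := by
  refine commute_of_mem_crossedProduct ha (fun f' => ?_) (fun g => rfl)
  ext1 ξ
  apply lp.ext
  funext h
  exact mulOp_comm _ _ _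

/-- `(ρ_k ξ)(h) = ξ(h k)` on `ℓ²(Γ, L²(X, ν))`. -/
def rightTranslation (ν : Measure X) (k : Γ) : HilbertSp Γ ν →ₗᵢ[ℂ] HilbertSp Γ ν where
  toFun ξ := ⟨fun h => ξ (h * k), memℓp_gen
    ((Equiv.mulRight k).summable_iff.2 ((lp.memℓp ξ).summable (by norm_num)))⟩
  map_add' _ _ := rfl
  map_smul' _ _ := rfl
  norm_map' ξ := by
    rw [lp.norm_eq_tsum_rpow (by norm_num), lp.norm_eq_tsum_rpow (by norm_num)]
    congr 1
    exact (Equiv.mulRight k).tsum_eq fun h => ‖ξ h‖ ^ (2 : ℝ≥0∞).toReal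

/-- `(R_h ξ)(k) = ξ(k h⁻¹) ∘ h`, an operator in the commutant of the crossed product. -/
def IsStationary.rightOp [NonsingularAction Γ ν] {μ : PMF Γ}
    (hstat : IsStationary μ ν) {h : Γ} (hh : h ∈ μ.support) :
    HilbertSp Γ ν →L[ℂ] HilbertSp Γ ν :=
  lp.mapCLM 2 (fun _ : Γ => hstat.compOp hh) (norm_nonneg _) (fun _ => le_rfl) ∘L
    (rightTranslation ν h⁻¹).toContinuousLinearMap

theorem IsStationary.rightOp_apply [NonsingularAction Γ ν] {μ : PMF Γ}
    (hstat : IsStationary μ ν) {h : Γ} (hh : h ∈ μ.support) (ξ : HilbertSp Γ ν) (k : Γ) :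
    hstat.rightOp hh ξ k = hstat.compOp hh (ξ (k * h⁻¹)) := rfl

/-- Left and right translations commute. For `π(f)`, composition with `h` turns `σ_{(kh⁻¹)⁻¹} f`
into `σ_{k⁻¹} f`, undoing the index shift. -/
theorem IsStationary.rightOp_commute [NonsingularAction Γ ν] {μ : PMF Γ}
    (hstat : IsStationary μ ν) {h : Γ} (hh : h ∈ μ.support)
    {a : HilbertSp Γ ν →L[ℂ] HilbertSp Γ ν} (ha : a ∈ (crossedProduct Γ ν).toStarSubalgebra) :
    hstat.rightOp hh * a = a * hstat.rightOp hh := by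
  refine commute_of_mem_crossedProduct ha (fun f => ?_) (fun g => ?_)
  · ext1 ξ
    apply lp.ext
    funext k
    rw [mul_apply_eq_comp, mul_apply_eq_comp, piRep_apply,
      hstat.rightOp_apply, hstat.rightOp_apply, piRep_apply, hstat.compOp_mulOp]
    simp
  · ext1 ξ
    apply lp.ext
    funext k
    rw [mul_apply_eq_comp, mul_apply_eq_comp, leftRegular_apply,
      hstat.rightOp_apply, hstat.rightOp_apply, leftRegular_apply, mul_assoc]

theorem lintegral_enorm_sq_eq (f : Lp ℂ 2 ν) : ∫⁻ x, ‖f x‖ₑ ^ 2 ∂ν = ‖f‖ₑ ^ 2 := by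
  have h := eLpNorm_nnreal_pow_eq_lintegral (f := f) (μ := ν) (p := 2) (by norm_num)
  rw [Lp.enorm_def]
  simpa using h.symm

theorem tsum_enorm_sq_ne_top (ξ : HilbertSp Γ ν) : ∑' g, ‖ξ g‖ₑ ^ 2 ≠ ∞ := by
  have h : Summable fun g => ‖ξ g‖ ^ 2 := by
    simpa using (lp.memℓp ξ).summable (by norm_num)
  have h' := h.tsum_ofReal_ne_top
  simpa [ENNReal.ofReal_pow] using h'

/-! ### The vector `δ_e ⊗ 1` and Fourier coefficients -/

variable [IsFiniteMeasure ν]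

open Classical in
variable (Γ ν) in
/-- The vector `δ_e ⊗ 1` of `ℓ²(Γ, L²(X, ν))`. -/
def vacuum : HilbertSp Γ ν := lp.single 2 1 (Lp.const 2 ν 1)

open Classical in
theorem leftRegular_vacuum (g : Γ) :
    (leftRegular Γ ν g : HilbertSp Γ ν →L[ℂ] HilbertSp Γ ν) (vacuum Γ ν) =
      lp.single 2 g (Lp.const 2 ν 1) := by
  apply lp.ext
  funext h
  rw [leftRegular_apply, vacuum]
  by_cases hg : h = g
  · subst hg; simp
  · rw [lp.single_apply_ne _ _ _ hg, lp.single_apply_ne]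
    rwa [Ne, inv_mul_eq_one, eq_comm]

theorem IsStationary.compOp_const [NonsingularAction Γ ν] {μ : PMF Γ}
    (hstat : IsStationary μ ν) {h : Γ} (hh : h ∈ μ.support) (c : ℂ) :
    hstat.compOp hh (Lp.const 2 ν c) = Lp.const 2 ν c := by
  have hq := NonsingularAction.quasiMeasurePreserving (ν := ν) h
  apply Lp.ext
  filter_upwards [hstat.coeFn_compOp hh (Lp.const 2 ν c), Lp.coeFn_const (p := 2) (μ := ν) c,
    hq.ae (Lp.coeFn_const (p := 2) (μ := ν) c)] with x h1 h2 h3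
  rw [h1, h2, h3]; rfl

/-- Composition with `h` fixes constants, which is why `R_h` carries no Radon–Nikodym factor
although it is then not unitary in general. -/
theorem IsStationary.rightOp_vacuum [NonsingularAction Γ ν] {μ : PMF Γ}
    (hstat : IsStationary μ ν) {h : Γ} (hh : h ∈ μ.support) :
    hstat.rightOp hh (vacuum Γ ν) =
      (leftRegular Γ ν h : HilbertSp Γ ν →L[ℂ] HilbertSp Γ ν) (vacuum Γ ν) := by
  classical
  rw [leftRegular_vacuum]
  apply lp.ext
  funext k
  rw [hstat.rightOp_apply, vacuum]
  by_cases hk : k = h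
  · subst hk; simp [hstat.compOp_const]
  · rw [lp.single_apply_ne _ _ _ hk, lp.single_apply_ne, map_zero]
    rwa [Ne, mul_inv_eq_one]

theorem mulOp_indicatorConstLp_one (c : ℂ) {s : Set X} (hs : MeasurableSet s) :
    mulOp (indicatorConstLp ∞ hs (measure_ne_top ν s) c) (Lp.const 2 ν 1) =
      indicatorConstLp 2 hs (measure_ne_top ν s) c := by
  apply Lp.ext
  filter_upwards [coeFn_mulOp (indicatorConstLp ∞ hs (measure_ne_top ν s) c) (Lp.const 2 ν 1),
    indicatorConstLp_coeFn (p := ∞) (hs := hs) (hμs := measure_ne_top ν s) (c := c),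
    indicatorConstLp_coeFn (p := 2) (hs := hs) (hμs := measure_ne_top ν s) (c := c),
    Lp.coeFn_const (p := 2) (μ := ν) (1 : ℂ)] with x h1 h2 h3 h4
  rw [h1, h2, h3, h4]; simp

/-- `δ_e ⊗ 1` separates the elements of the crossed product that commute with all `λ_g` from the
scalars. -/
theorem eq_smul_one_of_apply_vacuum [NonsingularAction Γ ν]
    {a : HilbertSp Γ ν →L[ℂ] HilbertSp Γ ν} (ha : a ∈ (crossedProduct Γ ν).toStarSubalgebra)
    (hL : ∀ g : Γ, (leftRegular Γ ν g : HilbertSp Γ ν →L[ℂ] HilbertSp Γ ν) * a =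
      a * leftRegular Γ ν g) {c : ℂ} (hc : a (vacuum Γ ν) = c • vacuum Γ ν) : a = c • 1 := by
  classical
  have hsingle : ∀ g : Γ, a (lp.single 2 g (Lp.const 2 ν 1)) =
      c • lp.single 2 g (Lp.const 2 ν 1) := by
    intro g
    rw [← leftRegular_vacuum, ← mul_apply_eq_comp, ← hL,
      mul_apply_eq_comp, hc, map_smul]
  have hdiag : ∀ (g : Γ) (f : Lp ℂ ∞ ν), diagMulOp Γ f (lp.single 2 g (Lp.const 2 ν 1)) =
      lp.single 2 g (mulOp f (Lp.const 2 ν 1)) := by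
    intro g f
    apply lp.ext
    funext h
    rw [diagMulOp_apply]
    by_cases hg : h = g
    · subst hg; simp
    · rw [lp.single_apply_ne _ _ _ hg, lp.single_apply_ne _ _ _ hg, map_zero]
  refine lp.ext_continuousLinearMap (by norm_num) fun g => ?_
  ext1 ξ
  change a (lp.single 2 g ξ) = c • lp.single 2 g ξ
  induction ξ using Lp.induction (p := 2) ENNReal.ofNat_ne_top with
  | indicatorConst z hs hμs =>
    -- `δ_g ⊗ z 1_s` is a diagonal multiplication applied to `δ_g ⊗ 1`, and `a` commutes with that
    -- multiplication.
    rw [Lp.simpleFunc.coe_indicatorConst, ← mulOp_indicatorConstLp_one, ← hdiag,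
      ← mul_apply_eq_comp, ← diagMulOp_commute _ ha, mul_apply_eq_comp,
      hsingle, map_smul]
  | add hf hg _ h1 h2 => rw [lp.single_add, map_add, h1, h2, smul_add]
  | isClosed =>
    have hcont : Continuous fun ξ : Lp ℂ 2 ν => (lp.single 2 g ξ : HilbertSp Γ ν) :=
      (lp.singleContinuousLinearMap ℂ (fun _ : Γ => Lp ℂ 2 ν) 2 g).continuous
    exact isClosed_eq (a.continuous.comp hcont) (hcont.const_smul c)

/-- The Fourier coefficients of an element of the crossed product commuting with all `λ_g` are
permuted by conjugation. -/
theorem IsStationary.compOp_apply_vacuum [NonsingularAction Γ ν] {μ : PMF Γ}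
    (hstat : IsStationary μ ν) {h : Γ} (hh : h ∈ μ.support)
    {a : HilbertSp Γ ν →L[ℂ] HilbertSp Γ ν} (ha : a ∈ (crossedProduct Γ ν).toStarSubalgebra)
    (hL : ∀ g : Γ, (leftRegular Γ ν g : HilbertSp Γ ν →L[ℂ] HilbertSp Γ ν) * a =
      a * leftRegular Γ ν g) (g : Γ) :
    hstat.compOp hh (a (vacuum Γ ν) g) = a (vacuum Γ ν) (h⁻¹ * g * h) := by
  have key : hstat.rightOp hh (a (vacuum Γ ν)) =
      (leftRegular Γ ν h : HilbertSp Γ ν →L[ℂ] HilbertSp Γ ν) (a (vacuum Γ ν)) := by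
    rw [← mul_apply_eq_comp, hstat.rightOp_commute hh ha,
      mul_apply_eq_comp, hstat.rightOp_vacuum, ← mul_apply_eq_comp, ← hL,
      mul_apply_eq_comp]
  -- At index `g * h`, the right shift reads coordinate `g` and the left shift reads `h⁻¹ * g * h`.
  have := congrArg (fun ξ : HilbertSp Γ ν => ξ (g * h)) key
  simpa [hstat.rightOp_apply, leftRegular_apply, mul_assoc] using this

/-- An element of the crossed product of an ergodic stationary action of an icc group that commutes
with all `λ_g` is a scalar. -/
theorem exists_eq_smul_one [NonsingularAction Γ ν] (hΓ : IsICC Γ) {μ : PMF Γ}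
    (hμ : Subgroup.closure μ.support = ⊤) (hstat : IsStationary μ ν)
    (herg : IsErgodicAction Γ ν) {a : HilbertSp Γ ν →L[ℂ] HilbertSp Γ ν}
    (ha : a ∈ (crossedProduct Γ ν).toStarSubalgebra)
    (hL : ∀ g : Γ, (leftRegular Γ ν g : HilbertSp Γ ν →L[ℂ] HilbertSp Γ ν) * a =
      a * leftRegular Γ ν g) : ∃ c : ℂ, a = c • 1 := by
  classical
  have hη := fun (h : Γ) (hh : h ∈ μ.support) => hstat.compOp_apply_vacuum hh ha hL
  set η := a (vacuum Γ ν) with hη_def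
  have hharm : ∀ g, ‖η g‖ₑ ^ 2 = ∑' h, μ h * ‖η (h⁻¹ * g * h)‖ₑ ^ 2 := by
    intro g
    rw [← lintegral_enorm_sq_eq, hstat.lintegral_eq
      ((Lp.stronglyMeasurable (η g)).measurable.enorm.pow_const 2)]
    congr 1 with h
    by_cases hh : h ∈ μ.support
    · rw [← hη h hh, ← lintegral_enorm_sq_eq]
      congr 1
      apply lintegral_congr_ae
      filter_upwards [hstat.coeFn_compOp hh (η g)] with x hx
      rw [hx]
    · rw [(μ.apply_eq_zero_iff h).2 hh, zero_mul, zero_mul]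
  have hzero : ∀ g, g ≠ 1 → η g = 0 := fun g hg => by
    simpa using hΓ.eq_zero_of_conj_harmonic μ hμ _ (tsum_enorm_sq_ne_top η) hharm g hg
  -- Conjugation fixes `1`, so `η 1` is invariant under the support of `μ`, hence under all of `Γ`.
  obtain ⟨c, hc⟩ := herg.ae_eq_const (Lp.stronglyMeasurable (η 1)).measurable
    (ae_invariant_of_closure_eq_top hμ fun h hh => by
      have h1 := hη h hh 1
      rw [mul_one, inv_mul_cancel] at h1
      have h2 := hstat.coeFn_compOp hh (η 1)
      rw [h1] at h2
      exact h2.symm)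
  refine ⟨c, eq_smul_one_of_apply_vacuum ha hL ?_⟩
  rw [← hη_def]
  apply lp.ext
  funext g
  rw [lp.coeFn_smul, Pi.smul_apply, vacuum]
  by_cases hg : g = 1
  · subst hg
    rw [lp.single_apply_self]
    apply Lp.ext
    filter_upwards [hc, Lp.coeFn_smul c (Lp.const 2 ν (1 : ℂ)),
      Lp.coeFn_const (p := 2) (μ := ν) (1 : ℂ)] with x h1 h2 h3
    rw [h1, h2, Pi.smul_apply, h3]; simp
  · rw [hzero g hg, lp.single_apply_ne _ _ _ hg, smul_zero]

end Action

end CrossedProductErgodicity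

end

theorem lemma3 {Γ X : Type*} [Group Γ] [MulAction Γ X] [MeasurableSpace X]
    (hΓ : CrossedProductErgodicity.IsICC Γ)
    (μ : PMF Γ) (hμ : Subgroup.closure μ.support = ⊤)
    (ν : MeasureTheory.Measure X) [MeasureTheory.IsProbabilityMeasure ν]
    [CrossedProductErgodicity.NonsingularAction Γ ν]
    (hstat : CrossedProductErgodicity.IsStationary μ ν)
    (herg : CrossedProductErgodicity.IsErgodicAction Γ ν) :
    CrossedProductErgodicity.IsErgodicAutAction
      (CrossedProductErgodicity.conjugationAction Γ ν) := by
  open CrossedProductErgodicity in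
  refine Set.Subset.antisymm (fun a ha => ?_) ?_
  · have hL : ∀ g : Γ, (leftRegular Γ ν g : HilbertSp Γ ν →L[ℂ] HilbertSp Γ ν) * a =
        a * leftRegular Γ ν g := by
      intro g
      have h : (leftRegular Γ ν g : HilbertSp Γ ν →L[ℂ] HilbertSp Γ ν) * a *
          star (leftRegular Γ ν g : HilbertSp Γ ν →L[ℂ] HilbertSp Γ ν) = a :=
        congrArg Subtype.val (ha g)
      calc (leftRegular Γ ν g : HilbertSp Γ ν →L[ℂ] HilbertSp Γ ν) * a
          = leftRegular Γ ν g * a * star (leftRegular Γ ν g : HilbertSp Γ ν →L[ℂ] HilbertSp Γ ν) *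
              leftRegular Γ ν g := by
            rw [mul_assoc _ (star _), Unitary.coe_star_mul_self, mul_one]
        _ = a * leftRegular Γ ν g := by rw [h]
    obtain ⟨c, hc⟩ := exists_eq_smul_one hΓ hμ hstat herg a.2 hL
    refine ⟨c, Subtype.ext ?_⟩
    rw [hc, Algebra.algebraMap_eq_smul_one]
    rfl
  · rintro _ ⟨c, rfl⟩ g
    exact AlgHomClass.commutes (conjugationAction Γ ν g) c
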